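/- Let $X$ be a measurable space, $Y\subseteq\mathbb{R}$, $\rho$ a probability measure on $X\times Y$, $\mathcal{F}$ a real separable Hilbert space, $\Phi:X\to\mathcal{F}$ measurable, and $V:\mathbb{R}\times\mathbb{R}\to[0,\infty)$ measurable. For $w\in\mathcal{F}$ put $\mathcal{E}(w)=\int V(y,\langle w,\Phi(x)\rangle)\,d\rho(x,y)$, and for $\lambda>0$ put $\mathcal{D}(\lambda)=\inf_{w\in\mathcal{F}}\{\mathcal{E}(w)+\frac{\lambda}{2}\|w\|^2\}-\inf_{w\in\mathcal{F}}\mathcal{E}(w)$. Assume: (1) $\kappa=\sup_{x\in X}\|\Phi(x)\|<\infty$; $V(y,\cdot)$ is convex for every $y\in Y$; $\sup_{y\in Y}V(y,0)<\infty$; and the left-hand derivative satisfies $|V'_-(y,a)|\le a_0$ for all $a\in\mathbb{R}$, $y\in Y$. (2) For some $\beta\in(0,1]$ and $c_\beta>0$, $\mathcal{D}(\lambda)\le c_\beta\lambda^\beta$ for all $\lambda>0$. (3) For every $y\in Y$, $V(y,\cdot)$ is differentiable and $V'(y,\cdot)$ is Lipschitz continuous with constant $L>0$. Let $m\ge 1$,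 let $z_i=(x_i,y_i)$, $i=1,\dots,m$, be i.i.d. from $\rho$, and let $j_1,j_2,\dots$ be i.i.d. uniform on $\{1,\dots,m\}$, independent of the sample. Let $(\eta_t)_{t\ge1}$ be a non-increasing sequence of positive numbers with $\eta_t\le 2/(\kappa^2L)$ for all $t\ge 1$ (no restriction if $\kappa=0$). Let $w_1=0$, $w_{t+1}=w_t-\eta_tV'_-(y_{j_t},\langle w_t,\Phi(x_{j_t})\rangle)\Phi(x_{j_t})$ and $\overline{w}_t=\sum_{k=1}^t\eta_kw_k\big/\sum_{k=1}^t\eta_k$ for $t\ge 1$. Then there is a constant $C>0$ depending only on $a_0$, $\kappa$ and $c_\beta$ such that for all $t\ge1$ the excess risks below are integrable and $$\mathbb{E}\Big[\mathcal{E}(\overline{w}_t)-\inf_{w\in\mathcal{F}}\mathcal{E}(w)\Big]\le C\left(\frac{\sum_{k=1}^t\eta_k}{m}+\frac{\sum_{k=1}^t\eta_k^2}{\sum_{k=1}^t\eta_k}+\Big(\frac{1}{\sum_{k=1}^t\eta_k}\Big)^{\beta}\right),$$ $$\mathbb{E}\Big[\mathcal{E}(w_t)-\inf_{w\in\mathcal{F}}\mathcal{E}(w)\Big]\le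 C\left(\frac{\sum_{k=1}^t\eta_k}{m}\sum_{k=1}^{t-1}\frac{\eta_k}{\eta_t(t-k)}+\Big(\sum_{k=1}^{t-1}\frac{\eta_k^2}{\eta_t(t-k)}+\eta_t\Big)+\frac{\big(\sum_{k=1}^t\eta_k\big)^{1-\beta}}{\eta_t\,t}\right),$$ where the expectation is over the sample and the indices. -/

import Mathlib

open MeasureTheory

noncomputable section

namespace SGM

/-- The left-hand derivative `V'_-(y, a)` of `V(y, ·)` at `a`. -/
def leftDeriv (V : ℝ → ℝ → ℝ) (y a : ℝ) : ℝ :=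
  derivWithin (V y) (Set.Iio a) a

section

variable {X : Type*} {Y : Set ℝ} {F : Type*} [NormedAddCommGroup F] [InnerProductSpace ℝ F]

/-- The expected risk `𝓔(w) = ∫ V(y, ⟨w, Φ(x)⟩) dρ` of the function `x ↦ ⟨w, Φ(x)⟩`. -/
def risk [MeasurableSpace X] (ρ : Measure (X × Y)) (V : ℝ → ℝ → ℝ) (Φ : X → F) (w : F) : ℝ :=
  ∫ z, V z.2 (inner ℝ w (Φ z.1)) ∂ρ

/-- The minimal risk `inf_{w ∈ F} 𝓔(w)`. -/
def infRisk [MeasurableSpace X] (ρ : Measure (X × Y)) (V : ℝ → ℝ → ℝ) (Φ : X → F) : ℝ :=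
  ⨅ w : F, risk ρ V Φ w

/-- The approximation error `𝓓(lam)`. -/
def approxError [MeasurableSpace X] (ρ : Measure (X × Y)) (V : ℝ → ℝ → ℝ) (Φ : X → F)
    (lam : ℝ) : ℝ :=
  (⨅ w : F, (risk ρ V Φ w + lam / 2 * ‖w‖ ^ 2)) - infRisk ρ V Φ

/-- The stochastic gradient method on the sample `z` with step-sizes `η 1, η 2, …` and
indices `j 1, j 2, …`: `w 1 = 0` and
`w (t + 1) = w t - η t * V'_-(y_{j t}, ⟨w t, Φ(x_{j t})⟩) • Φ(x_{j t})` for `t ≥ 1`.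
(The values at time `0` play no role.) -/
def iterate {m : ℕ} (V : ℝ → ℝ → ℝ) (Φ : X → F) (η : ℕ → ℝ)
    (z : Fin m → X × Y) (j : ℕ → Fin m) : ℕ → F
  | 0 => 0
  | 1 => 0
  | t + 2 =>
    iterate V Φ η z j (t + 1) -
      (η (t + 1) * leftDeriv V (z (j (t + 1))).2
        (inner ℝ (iterate V Φ η z j (t + 1)) (Φ (z (j (t + 1))).1))) • Φ (z (j (t + 1))).1

/-- The weighted averages `(∑_{k=1}^t η k • w k) / ∑_{k=1}^t η k` of the iterates. -/
def avgIterate {m : ℕ} (V : ℝ → ℝ → ℝ) (Φ : X → F) (η : ℕ → ℝ)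
    (z : Fin m → X × Y) (j : ℕ → Fin m) (t : ℕ) : F :=
  (∑ k ∈ Finset.Icc 1 t, η k)⁻¹ • ∑ k ∈ Finset.Icc 1 t, η k • iterate V Φ η z j k

/-- The joint law of the sample `z` (i.i.d. from `ρ`) and of the index sequence `j`
(i.i.d. uniform on the `m` indices, independent of `z`). -/
def jointLaw [MeasurableSpace X] (ρ : Measure (X × Y)) (m : ℕ) [NeZero m] :
    Measure ((Fin m → X × Y) × (ℕ → Fin m)) :=
  (Measure.pi fun _ : Fin m => ρ).prod
    (Measure.infinitePi fun _ : ℕ => (PMF.uniformOfFintype (Fin m)).toMeasure)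

/-- Boundedness: `κ = sup_x ‖Φ(x)‖ < ∞`, convexity of the loss in its second argument,
`sup_{y ∈ Y} V(y, 0) < ∞`, and a left-hand derivative bounded by `a₀`. -/
structure Bounded (Y : Set ℝ) (V : ℝ → ℝ → ℝ) (Φ : X → F) (κ a₀ : ℝ) : Prop where
  isLUB_norm : IsLUB (Set.range fun x => ‖Φ x‖) κ
  convex : ∀ y ∈ Y, ConvexOn ℝ Set.univ (V y)
  bddAbove_zero : BddAbove ((fun y => V y 0) '' Y)
  leftDeriv_le : ∀ y ∈ Y, ∀ a : ℝ, |leftDeriv V y a| ≤ a₀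

end

/-- The loss is differentiable in its second argument with `L`-Lipschitz derivative. -/
structure Smooth (Y : Set ℝ) (V : ℝ → ℝ → ℝ) (L : ℝ) : Prop where
  pos : 0 < L
  differentiable : ∀ y ∈ Y, Differentiable ℝ (V y)
  lipschitz : ∀ y ∈ Y, ∀ a b : ℝ, |deriv (V y) b - deriv (V y) a| ≤ L * |b - a|

end SGM

end

/-! The excess risk splits into a generalization gap, an optimization error on the sample and an
approximation error.

Gap: if `η t * (κ ^ 2 * L) ≤ 2`, a gradient step is nonexpansive (`norm_step_sub_step_le`), so runs
on two samples differing in one example separate only when that example is drawn. Each time draws a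
single index, so the separations summed over all `m` replacements stay below `2 * (a₀ * κ) * ∑ η`
(`sum_norm_iterate_update_sub_le`). Exchanging a sample point with a fresh one turns this into a gap
of order `(a₀ * κ) ^ 2 * ∑ η / m` (`abs_integral_risk_sub_empRisk_le`).

Optimization: expanding `‖w (i + 1) - u‖ ^ 2` and telescoping bounds the expected regret against any
bounded `u` that ignores the current and later indices (`sum_mul_integral_empRisk_sub_le`). For
constant `u` the empirical risk has mean `𝓔(u)`; dividing by `S = ∑ η` turns `‖u‖ ^ 2 / 2` into the
penalty with `lam = 1 / S`, and the infimum over `u` produces `𝓓(1 / S)`. Jensen's inequality then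
settles the averaged iterate.

Last iterate: taking `u = w s` makes the initial distance vanish, so the regret of the tail from `s`
measures how far later values exceed the value at `s`. Comparing averages over the last `k + 1` and
`k + 2` terms through these bounds, and summing over `k`, gives the weights `1 / (t - k)`
(`last_le_average_add`, `last_le_of_regret`). -/

noncomputable section

namespace SGM

/-! ### Deterministic estimates: gradient steps, growth and stability of the iterates. -/

section Pointwise

variable {X : Type*} {Y : Set ℝ} {F : Type*} [NormedAddCommGroup F] [InnerProductSpace ℝ F]
  {V : ℝ → ℝ → ℝ} {Φ : X → F} {κ a₀ L : ℝ}

/-- The loss of the predictor `w` at the example `z`. -/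
def loss (V : ℝ → ℝ → ℝ) (Φ : X → F) (w : F) (z : X × Y) : ℝ :=
  V z.2 (inner ℝ w (Φ z.1))

/-- The derivative of the loss at the prediction of `w` on `z`. -/
def slope (V : ℝ → ℝ → ℝ) (Φ : X → F) (w : F) (z : X × Y) : ℝ :=
  leftDeriv V z.2 (inner ℝ w (Φ z.1))

/-- One gradient step of size `h` at the example `z`. -/
def step (V : ℝ → ℝ → ℝ) (Φ : X → F) (h : ℝ) (z : X × Y) (w : F) : F :=
  w - (h * slope V Φ w z) • Φ z.1

theorem iterate_one {m : ℕ} (η : ℕ → ℝ) (z : Fin m → X × Y) (j : ℕ → Fin m) :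
    iterate V Φ η z j 1 = 0 := rfl

theorem iterate_succ {m : ℕ} (η : ℕ → ℝ) (z : Fin m → X × Y) (j : ℕ → Fin m) {t : ℕ}
    (ht : 1 ≤ t) :
    iterate V Φ η z j (t + 1) = step V Φ (η t) (z (j t)) (iterate V Φ η z j t) := by
  obtain ⟨t, rfl⟩ := Nat.exists_eq_add_of_le' ht
  rfl

/-- Causality: this is what makes the iterate at time `t` independent of the index drawn at time
`t`. -/
theorem iterate_congr {m : ℕ} (η : ℕ → ℝ) (z : Fin m → X × Y) {j j' : ℕ → Fin m} (t : ℕ)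
    (h : ∀ s < t, j s = j' s) : iterate V Φ η z j t = iterate V Φ η z j' t := by
  induction t with
  | zero => rfl
  | succ t ih =>
    rcases Nat.eq_zero_or_pos t with rfl | ht
    · rfl
    · rw [iterate_succ η z j ht, iterate_succ η z j' ht, h t (by omega),
        ih fun s hs => h s (by omega)]

theorem leftDeriv_eq_deriv (hS : Smooth Y V L) {y : ℝ} (hy : y ∈ Y) (a : ℝ) :
    leftDeriv V y a = deriv (V y) a :=
  (hS.differentiable y hy a).derivWithin (uniqueDiffWithinAt_Iio a)

theorem abs_slope_le (hB : Bounded Y V Φ κ a₀) (w : F) (z : X × Y) : |slope V Φ w z| ≤ a₀ :=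
  hB.leftDeriv_le z.2 z.2.2 _

theorem bound_nonneg (hB : Bounded Y V Φ κ a₀) (z : X × Y) : 0 ≤ κ ∧ 0 ≤ a₀ :=
  ⟨(norm_nonneg _).trans (hB.isLUB_norm.1 ⟨z.1, rfl⟩), (abs_nonneg _).trans (abs_slope_le hB 0 z)⟩

theorem abs_loss_sub_le (hB : Bounded Y V Φ κ a₀) (hS : Smooth Y V L) (u w : F) (z : X × Y) :
    |loss V Φ w z - loss V Φ u z| ≤ a₀ * κ * ‖w - u‖ := by
  have h := convex_univ.norm_image_sub_le_of_norm_deriv_le (f := V z.2) (C := a₀)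
    (x := inner ℝ u (Φ z.1)) (y := inner ℝ w (Φ z.1))
    (fun x _ => hS.differentiable _ z.2.2 x)
    (fun x _ => by
      rw [← leftDeriv_eq_deriv hS z.2.2]
      exact hB.leftDeriv_le z.2 z.2.2 x) trivial trivial
  rw [← inner_sub_left, Real.norm_eq_abs] at h
  obtain ⟨hκ, ha⟩ := bound_nonneg hB z
  calc _ ≤ _ := h
    _ ≤ a₀ * (‖w - u‖ * ‖Φ z.1‖) := by gcongr; exact norm_inner_le_norm _ _
    _ ≤ a₀ * (‖w - u‖ * κ) := by gcongr; exact hB.isLUB_norm.1 ⟨_, rfl⟩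
    _ = _ := by ring

/-- The graph of a convex function lies above its tangent at the prediction of `w`. -/
theorem slope_mul_le (hB : Bounded Y V Φ κ a₀) (hS : Smooth Y V L) (u w : F) (z : X × Y) :
    loss V Φ w z - loss V Φ u z ≤ slope V Φ w z * inner ℝ (w - u) (Φ z.1) := by
  have hc := hB.convex z.2 z.2.2
  have hd := hS.differentiable z.2 z.2.2
  simp only [loss, slope, leftDeriv_eq_deriv hS z.2.2, inner_sub_left]
  generalize inner ℝ w (Φ z.1) = p
  generalize inner ℝ u (Φ z.1) = q
  rcases lt_trichotomy p q with h | rfl | h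
  · have := hc.le_slope_of_hasDerivAt trivial trivial h (hd p).hasDerivAt
    rw [slope_def_field, le_div_iff₀ (by linarith)] at this
    linarith
  · simp
  · have := hc.slope_le_of_hasDerivAt trivial trivial h (hd p).hasDerivAt
    rw [slope_def_field, div_le_iff₀ (by linarith)] at this
    linarith

theorem exists_loss_le (hB : Bounded Y V Φ κ a₀) (hS : Smooth Y V L) :
    ∃ M : ℝ, ∀ (w : F) (z : X × Y), loss V Φ w z ≤ M + a₀ * κ * ‖w‖ := by
  obtain ⟨M, hM⟩ := hB.bddAbove_zero
  refine ⟨M, fun w z => ?_⟩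
  have h1 := (abs_le.1 (abs_loss_sub_le hB hS 0 w z)).2
  have h2 : loss V Φ 0 z ≤ M := hM ⟨z.2, z.2.2, by simp [loss]⟩
  rw [sub_zero] at h1
  linarith

theorem norm_step_sub_self_le (hB : Bounded Y V Φ κ a₀) {h : ℝ} (hh : 0 ≤ h) (w : F) (z : X × Y) :
    ‖step V Φ h z w - w‖ ≤ h * (a₀ * κ) := by
  obtain ⟨hκ, ha⟩ := bound_nonneg hB z
  rw [step, sub_sub_cancel_left, norm_neg, norm_smul, Real.norm_eq_abs, abs_mul, abs_of_nonneg hh,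
    mul_assoc]
  gcongr
  exacts [abs_slope_le hB w z, hB.isLUB_norm.1 ⟨_, rfl⟩]

/-- One-dimensional co-coercivity: the slope difference `δ` is monotone and Lipschitz in the
prediction difference `d`, so `δ ^ 2 ≤ L * (δ * d)`. Under the step-size condition the quadratic
term in the expanded square is then absorbed by the cross term `-2 * h * (δ * d)`. -/
theorem norm_step_sub_step_le (hB : Bounded Y V Φ κ a₀) (hS : Smooth Y V L) {h : ℝ} (hh : 0 ≤ h)
    (hL : h * (κ ^ 2 * L) ≤ 2) (u w : F) (z : X × Y) :
    ‖step V Φ h z w - step V Φ h z u‖ ≤ ‖w - u‖ := by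
  have hLp := hS.pos
  set d : ℝ := inner ℝ (w - u) (Φ z.1) with hd
  set δ : ℝ := slope V Φ w z - slope V Φ u z with hδ
  have hlip : |δ| ≤ L * |d| := by
    simp only [hδ, hd, slope, leftDeriv_eq_deriv hS z.2.2, inner_sub_left]
    exact hS.lipschitz z.2 z.2.2 _ _
  -- Monotonicity comes from adding the tangent inequalities at `w` and at `u`.
  have hmono : 0 ≤ δ * d := by
    have h1 := slope_mul_le hB hS u w z
    have h2 := slope_mul_le hB hS w u z
    rw [← neg_sub w u, inner_neg_left] at h2
    rw [hδ, sub_mul]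
    linarith
  have hsq : δ ^ 2 ≤ L * (δ * d) := by
    calc δ ^ 2 = |δ| * |δ| := by rw [abs_mul_abs_self, sq]
      _ ≤ L * |d| * |δ| := by gcongr
      _ = L * |δ * d| := by rw [abs_mul]; ring
      _ = _ := by rw [abs_of_nonneg hmono]
  have hΦ : ‖Φ z.1‖ ^ 2 ≤ κ ^ 2 := by gcongr; exact hB.isLUB_norm.1 ⟨_, rfl⟩
  have heq : step V Φ h z w - step V Φ h z u = (w - u) - (h * δ) • Φ z.1 := by
    simp only [step, hδ, mul_sub, sub_smul]
    abel
  have key : ‖(w - u) - (h * δ) • Φ z.1‖ ^ 2 ≤ ‖w - u‖ ^ 2 := by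
    rw [norm_sub_sq_real, inner_smul_right, norm_smul, mul_pow, Real.norm_eq_abs, sq_abs, ← hd]
    have h1 : (h * δ) ^ 2 * ‖Φ z.1‖ ^ 2 ≤ h * (δ * d) * 2 := by
      calc (h * δ) ^ 2 * ‖Φ z.1‖ ^ 2 ≤ (h * δ) ^ 2 * κ ^ 2 := by gcongr
        _ = h ^ 2 * κ ^ 2 * δ ^ 2 := by ring
        _ ≤ h ^ 2 * κ ^ 2 * (L * (δ * d)) := by gcongr
        _ = h * (δ * d) * (h * (κ ^ 2 * L)) := by ring
        _ ≤ _ := by gcongr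
    linarith
  rw [heq]
  exact le_of_sq_le_sq key (norm_nonneg _)

theorem norm_step_sub_sq_le (hB : Bounded Y V Φ κ a₀) (hS : Smooth Y V L) {h : ℝ} (hh : 0 ≤ h)
    (u w : F) (z : X × Y) :
    ‖step V Φ h z w - u‖ ^ 2 ≤
      ‖w - u‖ ^ 2 + h ^ 2 * (a₀ * κ) ^ 2 - 2 * h * (loss V Φ w z - loss V Φ u z) := by
  have h1 := slope_mul_le hB hS u w z
  have h2 : ‖(h * slope V Φ w z) • Φ z.1‖ ^ 2 ≤ h ^ 2 * (a₀ * κ) ^ 2 := by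
    have := norm_step_sub_self_le hB hh w z
    rw [step, sub_sub_cancel_left, norm_neg] at this
    calc _ ≤ (h * (a₀ * κ)) ^ 2 := by gcongr
      _ = _ := by ring
  have heq : step V Φ h z w - u = (w - u) - (h * slope V Φ w z) • Φ z.1 := by
    rw [step]; abel
  rw [heq, norm_sub_sq_real, inner_smul_right]
  have := mul_le_mul_of_nonneg_left h1 hh
  linarith

variable {η : ℕ → ℝ} {m : ℕ}

theorem norm_iterate_le (hB : Bounded Y V Φ κ a₀) (hη : ∀ t, 1 ≤ t → 0 < η t)
    (z : Fin m → X × Y) (j : ℕ → Fin m) (t : ℕ) :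
    ‖iterate V Φ η z j t‖ ≤ (∑ k ∈ Finset.Ico 1 t, η k) * (a₀ * κ) := by
  induction t with
  | zero => simp [iterate]
  | succ t ih =>
    rcases Nat.eq_zero_or_pos t with rfl | ht
    · simp [iterate]
    · rw [iterate_succ η z j ht, Finset.sum_Ico_succ_top ht, add_mul]
      have h1 := norm_step_sub_self_le hB (hη t ht).le (iterate V Φ η z j t) (z (j t))
      have h2 := norm_add_le (iterate V Φ η z j t)
        (step V Φ (η t) (z (j t)) (iterate V Φ η z j t) - iterate V Φ η z j t)
      rw [add_sub_cancel] at h2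
      linarith

/-- When `j k ≠ i` both runs apply the same nonexpansive map; when `j k = i` each moves by at most
`η k * (a₀ * κ)`, whence the factor 2. -/
theorem norm_iterate_update_sub_le (hB : Bounded Y V Φ κ a₀) (hS : Smooth Y V L)
    (hη : ∀ t, 1 ≤ t → 0 < η t) (hL : ∀ t, 1 ≤ t → η t * (κ ^ 2 * L) ≤ 2)
    (z : Fin m → X × Y) (i : Fin m) (x : X × Y) (j : ℕ → Fin m) (t : ℕ) :
    ‖iterate V Φ η (Function.update z i x) j t - iterate V Φ η z j t‖ ≤
      2 * (a₀ * κ) * ∑ k ∈ Finset.Ico 1 t, if j k = i then η k else 0 := by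
  induction t with
  | zero => simp [iterate]
  | succ t ih =>
    rcases Nat.eq_zero_or_pos t with rfl | ht
    · simp [iterate]
    · rw [iterate_succ η _ j ht, iterate_succ η z j ht, Finset.sum_Ico_succ_top ht, mul_add]
      set w := iterate V Φ η z j t
      set w' := iterate V Φ η (Function.update z i x) j t
      by_cases hj : j t = i
      · rw [if_pos hj]
        have h1 := norm_step_sub_self_le hB (hη t ht).le w (z (j t))
        have h2 := norm_step_sub_self_le hB (hη t ht).le w' (Function.update z i x (j t))
        set s := step V Φ (η t) (z (j t)) w
        set s' := step V Φ (η t) (Function.update z i x (j t)) w'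
        have h3 : s' - s = (s' - w') - (s - w) + (w' - w) := by abel
        have h4 := norm_add_le ((s' - w') - (s - w)) (w' - w)
        have h5 := norm_sub_le (s' - w') (s - w)
        rw [h3]
        linarith
      · rw [if_neg hj, Function.update_of_ne hj, mul_zero, add_zero]
        exact (norm_step_sub_step_le hB hS (hη t ht).le (hL t ht) _ _ _).trans ih

/-- After swapping the sums, each time `k` contributes for exactly one `i`, so no factor `m` appears
and no average over `j` is needed. -/
theorem sum_norm_iterate_update_sub_le (hB : Bounded Y V Φ κ a₀) (hS : Smooth Y V L)
    (hη : ∀ t, 1 ≤ t → 0 < η t) (hL : ∀ t, 1 ≤ t → η t * (κ ^ 2 * L) ≤ 2)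
    (z : Fin m → X × Y) (x : X × Y) (j : ℕ → Fin m) (t : ℕ) :
    ∑ i, ‖iterate V Φ η (Function.update z i x) j t - iterate V Φ η z j t‖ ≤
      2 * (a₀ * κ) * ∑ k ∈ Finset.Ico 1 t, η k := by
  refine (Finset.sum_le_sum fun i _ =>
    norm_iterate_update_sub_le hB hS hη hL z i x j t).trans_eq ?_
  rw [← Finset.mul_sum, Finset.sum_comm]
  simp

theorem norm_avgIterate_le (hB : Bounded Y V Φ κ a₀) (hη : ∀ t, 1 ≤ t → 0 < η t)
    (z : Fin m → X × Y) (j : ℕ → Fin m) (t : ℕ) :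
    ‖avgIterate V Φ η z j t‖ ≤ (∑ k ∈ Finset.Icc 1 t, η k)⁻¹ *
      ∑ k ∈ Finset.Icc 1 t, η k * ((∑ i ∈ Finset.Ico 1 k, η i) * (a₀ * κ)) := by
  have hpos : ∀ k ∈ Finset.Icc 1 t, 0 ≤ η k := fun k hk => (hη k (Finset.mem_Icc.1 hk).1).le
  have h0 : 0 ≤ (∑ k ∈ Finset.Icc 1 t, η k)⁻¹ := inv_nonneg.2 (Finset.sum_nonneg hpos)
  rw [avgIterate, norm_smul, Real.norm_of_nonneg h0]
  refine mul_le_mul_of_nonneg_left ((norm_sum_le _ _).trans (Finset.sum_le_sum fun k hk => ?_)) h0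
  rw [norm_smul, Real.norm_of_nonneg (hpos k hk)]
  exact mul_le_mul_of_nonneg_left (norm_iterate_le hB hη z j k) (hpos k hk)

end Pointwise

/-! ### Nonnegativity of the risk and its infimum. -/

section Risk

variable {X : Type*} [MeasurableSpace X] {Y : Set ℝ} {F : Type*} [NormedAddCommGroup F]
  [InnerProductSpace ℝ F] {V : ℝ → ℝ → ℝ} {Φ : X → F} {ρ : Measure (X × Y)}

theorem risk_nonneg (hV0 : ∀ y a, 0 ≤ V y a) (w : F) : 0 ≤ risk ρ V Φ w :=
  integral_nonneg fun _ => hV0 _ _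

theorem infRisk_le (hV0 : ∀ y a, 0 ≤ V y a) (w : F) : infRisk ρ V Φ ≤ risk ρ V Φ w :=
  ciInf_le ⟨0, by rintro _ ⟨u, rfl⟩; exact risk_nonneg hV0 u⟩ w

end Risk

/-! ### Measurability, integrability and convexity of the risk. -/

section Measurability

variable {X : Type*} [MeasurableSpace X] {Y : Set ℝ} {F : Type*} [NormedAddCommGroup F]
  [InnerProductSpace ℝ F] [TopologicalSpace.SeparableSpace F] [MeasurableSpace F] [BorelSpace F]
  {V : ℝ → ℝ → ℝ} {Φ : X → F} {κ a₀ L : ℝ}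

/-- Differentiability lets the derivative be computed as a limit of right difference quotients with
steps `1 / (n + 1)`. -/
theorem measurable_leftDeriv (hV : Measurable (Function.uncurry V)) (hS : Smooth Y V L) :
    Measurable fun p : Y × ℝ => leftDeriv V p.1 p.2 := by
  refine measurable_of_tendsto_metrizable (f := fun (n : ℕ) (p : Y × ℝ) =>
    (1 / ((n : ℝ) + 1))⁻¹ • (V p.1 (p.2 + 1 / ((n : ℝ) + 1)) - V p.1 p.2)) (fun n => ?_) ?_
  · have h1 : Measurable fun p : Y × ℝ => V p.1 (p.2 + 1 / ((n : ℝ) + 1)) :=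
      hV.comp (f := fun p : Y × ℝ => ((p.1 : ℝ), p.2 + 1 / ((n : ℝ) + 1))) (by fun_prop)
    have h2 : Measurable fun p : Y × ℝ => V p.1 p.2 :=
      hV.comp (f := fun p : Y × ℝ => ((p.1 : ℝ), p.2)) (by fun_prop)
    exact (h1.sub h2).const_smul ((1 / ((n : ℝ) + 1))⁻¹)
  · rw [tendsto_pi_nhds]
    rintro ⟨y, a⟩
    rw [leftDeriv_eq_deriv hS y.2]
    refine (hasDerivAt_iff_tendsto_slope_zero.1 (hS.differentiable y y.2 a).hasDerivAt).comp
      (tendsto_nhdsWithin_iff.2 ⟨tendsto_one_div_add_atTop_nhds_zero_nat, ?_⟩)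
    exact Filter.Eventually.of_forall fun n => (Nat.one_div_pos_of_nat (α := ℝ)).ne'

theorem measurable_prediction (hΦ : Measurable Φ) :
    Measurable fun p : F × X × Y => (inner ℝ p.1 (Φ p.2.1) : ℝ) := by
  have := UniformSpace.secondCountable_of_separable F
  exact measurable_fst.inner (hΦ.comp (measurable_fst.comp measurable_snd))

theorem measurable_loss (hV : Measurable (Function.uncurry V)) (hΦ : Measurable Φ) :
    Measurable fun p : F × X × Y => loss V Φ p.1 p.2 :=
  hV.comp ((measurable_subtype_coe.comp (measurable_snd.comp measurable_snd)).prodMk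
    (measurable_prediction hΦ))

theorem measurable_step (hV : Measurable (Function.uncurry V)) (hS : Smooth Y V L)
    (hΦ : Measurable Φ) (h : ℝ) :
    Measurable fun p : (X × Y) × F => step V Φ h p.1 p.2 := by
  have := UniformSpace.secondCountable_of_separable F
  have h1 : Measurable fun p : (X × Y) × F => slope V Φ p.2 p.1 :=
    ((measurable_leftDeriv hV hS).comp ((measurable_snd.comp measurable_snd).prodMk
      (measurable_prediction hΦ))).comp measurable_swap
  exact measurable_snd.sub ((h1.const_mul h).smul (hΦ.comp (measurable_fst.comp measurable_fst)))

theorem measurable_example {α : Type*} [MeasurableSpace α] {m : ℕ} (k : ℕ) :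
    Measurable fun p : (Fin m → α) × (ℕ → Fin m) => p.1 (p.2 k) := by
  have h : Measurable fun q : (Fin m → α) × Fin m => q.1 q.2 :=
    measurable_from_prod_countable_left fun i => measurable_pi_apply i
  exact h.comp (measurable_fst.prodMk ((measurable_pi_apply k).comp measurable_snd))

theorem measurable_iterate (hV : Measurable (Function.uncurry V)) (hS : Smooth Y V L)
    (hΦ : Measurable Φ) {m : ℕ} (η : ℕ → ℝ) (t : ℕ) :
    Measurable fun p : (Fin m → X × Y) × (ℕ → Fin m) => iterate V Φ η p.1 p.2 t := by
  induction t with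
  | zero => exact measurable_const
  | succ t ih =>
    rcases Nat.eq_zero_or_pos t with rfl | ht
    · exact measurable_const
    · simp only [iterate_succ η _ _ ht]
      exact (measurable_step hV hS hΦ (η t)).comp ((measurable_example t).prodMk ih)

theorem measurable_avgIterate (hV : Measurable (Function.uncurry V)) (hS : Smooth Y V L)
    (hΦ : Measurable Φ) {m : ℕ} (η : ℕ → ℝ) (t : ℕ) :
    Measurable fun p : (Fin m → X × Y) × (ℕ → Fin m) => avgIterate V Φ η p.1 p.2 t := by
  have := UniformSpace.secondCountable_of_separable F
  exact (Finset.measurable_fun_sum _ fun k _ =>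
    (measurable_iterate hV hS hΦ η k).const_smul (η k)).const_smul _

/-- The loss of a bounded random predictor on a random example is integrable. -/
theorem integrable_loss (hV : Measurable (Function.uncurry V)) (hV0 : ∀ y a, 0 ≤ V y a)
    (hB : Bounded Y V Φ κ a₀) (hS : Smooth Y V L) (hΦ : Measurable Φ)
    {Ω : Type*} [MeasurableSpace Ω] {P : Measure Ω} [IsFiniteMeasure P]
    {w : Ω → F} {x : Ω → X × Y} (hw : Measurable w) (hx : Measurable x)
    {K : ℝ} (hK : ∀ ω, ‖w ω‖ ≤ K) :
    Integrable (fun ω => loss V Φ (w ω) (x ω)) P := by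
  obtain ⟨M, hM⟩ := exists_loss_le hB hS
  refine Integrable.of_bound ((measurable_loss hV hΦ).comp (hw.prodMk hx)).aestronglyMeasurable
    (M + a₀ * κ * K) (Filter.Eventually.of_forall fun ω => ?_)
  obtain ⟨hκ, ha⟩ := bound_nonneg hB (x ω)
  rw [Real.norm_of_nonneg (show 0 ≤ loss V Φ (w ω) (x ω) from hV0 _ _)]
  refine (hM _ _).trans ?_
  have := hK ω
  gcongr

variable {ρ : Measure (X × Y)} [IsProbabilityMeasure ρ]

theorem integrable_loss_const (hV : Measurable (Function.uncurry V)) (hV0 : ∀ y a, 0 ≤ V y a)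
    (hB : Bounded Y V Φ κ a₀) (hS : Smooth Y V L) (hΦ : Measurable Φ) (w : F) :
    Integrable (loss V Φ w) ρ :=
  integrable_loss hV hV0 hB hS hΦ measurable_const measurable_id (w := fun _ => w) fun _ => le_rfl

theorem convexOn_risk (hV : Measurable (Function.uncurry V)) (hV0 : ∀ y a, 0 ≤ V y a)
    (hB : Bounded Y V Φ κ a₀) (hS : Smooth Y V L) (hΦ : Measurable Φ) :
    ConvexOn ℝ Set.univ (risk ρ V Φ) := by
  have hi := integrable_loss_const (ρ := ρ) hV hV0 hB hS hΦ
  refine ⟨convex_univ, fun u _ w _ a b ha hb hab => ?_⟩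
  have h1 : a • risk ρ V Φ u + b • risk ρ V Φ w =
      ∫ z, (a • loss V Φ u z + b • loss V Φ w z) ∂ρ := by
    refine Eq.trans ?_ (integral_add ((hi u).smul a) ((hi w).smul b)).symm
    simp only [Pi.smul_apply, integral_smul]
    rfl
  rw [h1]
  refine integral_mono (hi _) (((hi u).smul a).add ((hi w).smul b)) fun z => ?_
  have := (hB.convex z.2 z.2.2).2 (x := inner ℝ u (Φ z.1)) (y := inner ℝ w (Φ z.1)) trivial trivial
    ha hb hab
  simpa only [loss, inner_add_left, real_inner_smul_left, smul_eq_mul] using this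

theorem risk_avgIterate_le
    (hV : Measurable (Function.uncurry V)) (hV0 : ∀ y a, 0 ≤ V y a)
    (hB : Bounded Y V Φ κ a₀) (hS : Smooth Y V L) (hΦ : Measurable Φ)
    {m : ℕ} {η : ℕ → ℝ} (hη : ∀ t, 1 ≤ t → 0 < η t) (z : Fin m → X × Y) (j : ℕ → Fin m)
    {t : ℕ} (ht : 1 ≤ t) :
    risk ρ V Φ (avgIterate V Φ η z j t) ≤
      (∑ k ∈ Finset.Icc 1 t, η k)⁻¹ *
        ∑ k ∈ Finset.Icc 1 t, η k * risk ρ V Φ (iterate V Φ η z j k) := by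
  have hpos : ∀ k ∈ Finset.Icc 1 t, 0 < η k := fun k hk => hη k (Finset.mem_Icc.1 hk).1
  -- `avgIterate` unfolds to a `Finset.centerMass`, so this is Jensen's inequality.
  exact (convexOn_risk hV hV0 hB hS hΦ).map_centerMass_le (fun k hk => (hpos k hk).le)
    (Finset.sum_pos hpos ⟨1, by simp [ht]⟩) (fun _ _ => trivial)

theorem integrable_risk (hV : Measurable (Function.uncurry V)) (hV0 : ∀ y a, 0 ≤ V y a)
    (hB : Bounded Y V Φ κ a₀) (hS : Smooth Y V L) (hΦ : Measurable Φ)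
    {Ω : Type*} [MeasurableSpace Ω] {P : Measure Ω} [IsFiniteMeasure P]
    {w : Ω → F} (hw : Measurable w) {K : ℝ} (hK : ∀ ω, ‖w ω‖ ≤ K) :
    Integrable (fun ω => risk ρ V Φ (w ω)) P := by
  have h := integrable_loss (P := P.prod ρ) hV hV0 hB hS hΦ (hw.comp measurable_fst)
    measurable_snd (fun p => hK p.1)
  exact h.integral_prod_left

end Measurability

/-! ### Symmetries of product measures. -/

section Exchange

variable {α : Type*} [MeasurableSpace α]

/-- Exchanging one point of an i.i.d. sample with a fresh one preserves the joint law. -/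
theorem measurePreserving_exchange (ρ : Measure α) [SigmaFinite ρ] {m : ℕ} (i : Fin m) :
    MeasurePreserving (fun p : (Fin m → α) × α => (Function.update p.1 i p.2, p.1 i))
      ((Measure.pi fun _ => ρ).prod ρ) ((Measure.pi fun _ => ρ).prod ρ) := by
  -- With the fresh point stored at coordinate `0` of an `(m + 1)`-tuple, the exchange is the
  -- transposition of `0` and `i.succ`.
  have he := measurePreserving_piFinSuccAbove (fun _ : Fin (m + 1) => ρ) 0
  have hσ := measurePreserving_piCongrLeft (fun _ : Fin (m + 1) => ρ) (Equiv.swap 0 i.succ)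
  have h := Measure.measurePreserving_swap.comp (he.comp (hσ.comp ((he.symm _).comp
    (Measure.measurePreserving_swap (μ := Measure.pi fun _ : Fin m => ρ) (ν := ρ)))))
  convert h using 1
  funext p
  simp only [Function.comp_apply, MeasurableEquiv.coe_piCongrLeft]
  have hval (k : Fin (m + 1)) : Equiv.piCongrLeft (fun _ : Fin (m + 1) => α)
      (Equiv.swap 0 i.succ) ((MeasurableEquiv.piFinSuccAbove (fun _ => α) 0).symm p.swap) k =
      Fin.cons (α := fun _ => α) p.2 p.1 (Equiv.swap 0 i.succ k) := by
    obtain ⟨l, rfl⟩ := (Equiv.swap 0 i.succ).surjective k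
    rw [Equiv.piCongrLeft_apply_apply, Equiv.swap_apply_self]
    simp [MeasurableEquiv.piFinSuccAbove]
  refine Prod.ext (funext fun k => ?_) ?_
  · refine Eq.trans ?_ (hval k.succ).symm
    rcases eq_or_ne k i with rfl | hk
    · simp
    · rw [Equiv.swap_apply_of_ne_of_ne (Fin.succ_ne_zero k) (by simpa using hk)]
      simp [hk]
  · refine Eq.trans ?_ (hval 0).symm
    simp

/-- Resampling one coordinate preserves a product law. -/
theorem measurePreserving_update {ι : Type*} [DecidableEq ι] (μ : Measure α)
    [IsProbabilityMeasure μ] (i : ι) :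
    MeasurePreserving (fun p : (ι → α) × α => Function.update p.1 i p.2)
      ((Measure.infinitePi fun _ => μ).prod μ) (Measure.infinitePi fun _ => μ) := by
  refine ⟨measurable_update', Measure.eq_infinitePi _ fun s t ht => ?_⟩
  rw [Measure.map_apply measurable_update' (.pi s.countable_toSet fun i _ => ht i)]
  by_cases hi : i ∈ s
  · have h : (fun p : (ι → α) × α => Function.update p.1 i p.2) ⁻¹' Set.pi s t =
        Set.pi (s.erase i : Finset ι) t ×ˢ t i := by
      ext p
      simp only [Set.mem_preimage, Set.mem_pi, Finset.mem_coe, Set.mem_prod, Finset.mem_erase]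
      constructor
      · intro h
        exact ⟨fun k hk => by simpa [hk.1] using h k hk.2, by simpa using h i hi⟩
      · rintro ⟨h1, h2⟩ k hk
        rcases eq_or_ne k i with rfl | hki
        · simpa using h2
        · simpa [hki] using h1 k ⟨hki, hk⟩
    rw [h, Measure.prod_prod, Measure.infinitePi_pi _ fun i _ => ht i,
      Finset.prod_erase_mul s (fun k => μ (t k)) hi]
  · have h : (fun p : (ι → α) × α => Function.update p.1 i p.2) ⁻¹' Set.pi s t =
        Set.pi s t ×ˢ Set.univ := by
      ext p
      simp only [Set.mem_preimage, Set.mem_pi, Finset.mem_coe, Set.mem_prod, Set.mem_univ, and_true]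
      refine forall₂_congr fun k hk => ?_
      rw [Function.update_of_ne (ne_of_mem_of_not_mem hk hi)]
    rw [h, Measure.prod_prod, Measure.infinitePi_pi _ fun i _ => ht i, measure_univ, mul_one]

/-- The average over a finite type is the integral against the uniform law. -/
theorem integral_uniform {m : ℕ} [NeZero m] (f : Fin m → ℝ) :
    ∫ a, f a ∂(PMF.uniformOfFintype (Fin m)).toMeasure = (m : ℝ)⁻¹ * ∑ a, f a := by
  rw [PMF.integral_eq_sum, Finset.mul_sum]
  simp

end Exchange

/-! ### Generalization gap by stability, and expected regret. -/

section Expectation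

variable {X : Type*} [MeasurableSpace X] {Y : Set ℝ} {F : Type*} [NormedAddCommGroup F]
  [InnerProductSpace ℝ F] [TopologicalSpace.SeparableSpace F] [MeasurableSpace F] [BorelSpace F]
  {V : ℝ → ℝ → ℝ} {Φ : X → F} {κ a₀ L : ℝ} {ρ : Measure (X × Y)} [IsProbabilityMeasure ρ]
  {m : ℕ}

/-- The empirical risk of `w` on the sample `z`. -/
def empRisk {X : Type*} {Y : Set ℝ} {F : Type*} [NormedAddCommGroup F] [InnerProductSpace ℝ F]
    {m : ℕ} (V : ℝ → ℝ → ℝ) (Φ : X → F) (z : Fin m → X × Y) (w : F) : ℝ :=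
  (m : ℝ)⁻¹ * ∑ i, loss V Φ w (z i)

theorem integrable_empRisk (hV : Measurable (Function.uncurry V)) (hV0 : ∀ y a, 0 ≤ V y a)
    (hB : Bounded Y V Φ κ a₀) (hS : Smooth Y V L) (hΦ : Measurable Φ)
    {Ω : Type*} [MeasurableSpace Ω] {P : Measure Ω} [IsFiniteMeasure P]
    {w : Ω → F} {z : Ω → Fin m → X × Y} (hw : Measurable w) (hz : Measurable z)
    {K : ℝ} (hK : ∀ ω, ‖w ω‖ ≤ K) :
    Integrable (fun ω => empRisk V Φ (z ω) (w ω)) P :=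
  (integrable_finsetSum _ fun i _ =>
    integrable_loss hV hV0 hB hS hΦ hw ((measurable_pi_apply i).comp hz) hK).const_mul _

/-- Uniform stability of a learning rule bounds its generalization gap. -/
theorem abs_integral_risk_sub_empRisk_le [NeZero m]
    (hV : Measurable (Function.uncurry V)) (hV0 : ∀ y a, 0 ≤ V y a)
    (hB : Bounded Y V Φ κ a₀) (hS : Smooth Y V L) (hΦ : Measurable Φ)
    {h : (Fin m → X × Y) → F} (hh : Measurable h) {K D : ℝ} (hK : ∀ z, ‖h z‖ ≤ K)
    (hD : ∀ z x, ∑ i, ‖h (Function.update z i x) - h z‖ ≤ D) :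
    |∫ z, risk ρ V Φ (h z) ∂(Measure.pi fun _ => ρ) -
        ∫ z, empRisk V Φ z (h z) ∂(Measure.pi fun _ => ρ)| ≤ a₀ * κ * D / m := by
  set μ : Measure (Fin m → X × Y) := Measure.pi fun _ => ρ
  have hup (i : Fin m) :
      Measurable fun p : (Fin m → X × Y) × (X × Y) => h (Function.update p.1 i p.2) :=
    hh.comp measurable_update'
  have hz (i : Fin m) : Measurable fun p : (Fin m → X × Y) × (X × Y) => p.1 i :=
    (measurable_pi_apply i).comp measurable_fst
  have hi1 (i : Fin m) := integrable_loss (P := μ.prod ρ) hV hV0 hB hS hΦ (hup i) (hz i)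
    (fun p => hK _)
  have hi2 (i : Fin m) := integrable_loss (P := μ.prod ρ) hV hV0 hB hS hΦ
    (w := fun p => h p.1) (hh.comp measurable_fst) (hz i) (fun p => hK _)
  -- Swapping roles: a fresh test point against a rule trained on `z` has the same law as the test
  -- point `z i` against the rule trained with `z i` replaced.
  have hrisk (i : Fin m) : ∫ z, risk ρ V Φ (h z) ∂μ =
      ∫ p, loss V Φ (h (Function.update p.1 i p.2)) (p.1 i) ∂(μ.prod ρ) := by
    have hi := integrable_loss (P := μ.prod ρ) hV hV0 hB hS hΦ (w := fun p => h p.1)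
      (hh.comp measurable_fst) measurable_snd (fun p => hK _)
    have hex := measurePreserving_exchange ρ i
    calc ∫ z, risk ρ V Φ (h z) ∂μ = ∫ p, loss V Φ (h p.1) p.2 ∂(μ.prod ρ) :=
          (integral_prod _ hi).symm
      _ = _ := by
          conv_lhs => rw [← hex.map_eq]
          rw [integral_map hex.measurable.aemeasurable
            (by rw [hex.map_eq]; exact hi.aestronglyMeasurable)]
  have hemp (i : Fin m) : ∫ z, loss V Φ (h z) (z i) ∂μ =
      ∫ p, loss V Φ (h p.1) (p.1 i) ∂(μ.prod ρ) := by
    rw [integral_prod _ (hi2 i)]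
    simp
  have hemp' : ∫ z, empRisk V Φ z (h z) ∂μ =
      (m : ℝ)⁻¹ * ∑ i, ∫ p, loss V Φ (h p.1) (p.1 i) ∂(μ.prod ρ) := by
    simp only [empRisk]
    rw [integral_const_mul, integral_finsetSum]
    · simp only [hemp]
    · exact fun i _ => integrable_loss hV hV0 hB hS hΦ hh (measurable_pi_apply i) hK
  have hrisk' : ∫ z, risk ρ V Φ (h z) ∂μ = (m : ℝ)⁻¹ *
      ∑ i, ∫ p, loss V Φ (h (Function.update p.1 i p.2)) (p.1 i) ∂(μ.prod ρ) := by
    have hm : (m : ℝ) ≠ 0 := NeZero.ne _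
    rw [← Finset.sum_congr rfl fun i _ => hrisk i]
    simp [hm]
  have hdiff : ∫ z, risk ρ V Φ (h z) ∂μ - ∫ z, empRisk V Φ z (h z) ∂μ = (m : ℝ)⁻¹ *
      ∫ p, ∑ i, (loss V Φ (h (Function.update p.1 i p.2)) (p.1 i) - loss V Φ (h p.1) (p.1 i))
        ∂(μ.prod ρ) := by
    rw [hrisk', hemp', ← mul_sub, ← Finset.sum_sub_distrib, integral_finsetSum]
    · congr 1
      exact Finset.sum_congr rfl fun i _ => (integral_sub (hi1 i) (hi2 i)).symm
    · exact fun i _ => (hi1 i).sub (hi2 i)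
  have hbound : |∫ p, ∑ i, (loss V Φ (h (Function.update p.1 i p.2)) (p.1 i) -
      loss V Φ (h p.1) (p.1 i)) ∂(μ.prod ρ)| ≤ a₀ * κ * D := by
    have := norm_integral_le_of_norm_le_const (μ := μ.prod ρ) (C := a₀ * κ * D)
      (f := fun p => ∑ i, (loss V Φ (h (Function.update p.1 i p.2)) (p.1 i) -
        loss V Φ (h p.1) (p.1 i))) (Filter.Eventually.of_forall fun p => by
          obtain ⟨hκ, ha⟩ := bound_nonneg hB p.2
          calc _ ≤ ∑ i, a₀ * κ * ‖h (Function.update p.1 i p.2) - h p.1‖ :=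
                (Finset.abs_sum_le_sum_abs _ _).trans
                  (Finset.sum_le_sum fun i _ => abs_loss_sub_le hB hS _ _ _)
            _ ≤ _ := by
                rw [← Finset.mul_sum]
                have := hD p.1 p.2
                gcongr)
    simpa using this
  rw [hdiff, abs_mul, abs_of_nonneg (by positivity), inv_mul_eq_div]
  gcongr

variable [NeZero m]

instance : IsProbabilityMeasure (jointLaw ρ m) := by
  unfold jointLaw
  infer_instance

variable {η : ℕ → ℝ}

/-- For each fixed index sequence the iterate is a deterministic rule on the sample, so the
stability bound applies before integrating over `j`. -/
theorem abs_integral_risk_iterate_sub_le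
    (hV : Measurable (Function.uncurry V)) (hV0 : ∀ y a, 0 ≤ V y a)
    (hB : Bounded Y V Φ κ a₀) (hS : Smooth Y V L) (hΦ : Measurable Φ)
    (hη : ∀ t, 1 ≤ t → 0 < η t) (hL : ∀ t, 1 ≤ t → η t * (κ ^ 2 * L) ≤ 2) (t : ℕ) :
    |∫ p, risk ρ V Φ (iterate V Φ η p.1 p.2 t) ∂(jointLaw ρ m) -
        ∫ p, empRisk V Φ p.1 (iterate V Φ η p.1 p.2 t) ∂(jointLaw ρ m)| ≤
      2 * (a₀ * κ) ^ 2 / m * ∑ k ∈ Finset.Ico 1 t, η k := by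
  have hw := measurable_iterate hV hS hΦ (m := m) η t
  have hK (p : (Fin m → X × Y) × (ℕ → Fin m)) := norm_iterate_le hB hη p.1 p.2 t
  have hi1 := integrable_risk (ρ := ρ) (P := jointLaw ρ m) hV hV0 hB hS hΦ hw hK
  have hi2 := integrable_empRisk (P := jointLaw ρ m) hV hV0 hB hS hΦ hw measurable_fst hK
  unfold jointLaw at *
  rw [integral_prod_symm _ hi1, integral_prod_symm _ hi2,
    ← integral_sub hi1.integral_prod_right hi2.integral_prod_right]
  have := norm_integral_le_of_norm_le_const
    (μ := Measure.infinitePi fun _ : ℕ => (PMF.uniformOfFintype (Fin m)).toMeasure)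
    (f := fun j => ∫ z, risk ρ V Φ (iterate V Φ η z j t) ∂(Measure.pi fun _ : Fin m => ρ) -
      ∫ z, empRisk V Φ z (iterate V Φ η z j t) ∂(Measure.pi fun _ : Fin m => ρ))
    (C := 2 * (a₀ * κ) ^ 2 / m * ∑ k ∈ Finset.Ico 1 t, η k)
    (Filter.Eventually.of_forall fun j => by
      have h := abs_integral_risk_sub_empRisk_le (ρ := ρ) hV hV0 hB hS hΦ
        (hw.comp (measurable_id.prodMk (measurable_const (a := j)))) (fun z => hK (z, j))
        (fun z x => sum_norm_iterate_update_sub_le hB hS hη hL z x j t)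
      exact h.trans_eq (by ring))
  simpa using this

/-- At time `i` the example drawn is independent of a predictor that ignores the `i`-th index. -/
theorem integral_loss_example
    (hV : Measurable (Function.uncurry V)) (hV0 : ∀ y a, 0 ≤ V y a)
    (hB : Bounded Y V Φ κ a₀) (hS : Smooth Y V L) (hΦ : Measurable Φ) (i : ℕ)
    {u : (Fin m → X × Y) × (ℕ → Fin m) → F} (hu : Measurable u) {K : ℝ} (hK : ∀ p, ‖u p‖ ≤ K)
    (hi : ∀ z j a, u (z, Function.update j i a) = u (z, j)) :
    ∫ p, loss V Φ (u p) (p.1 (p.2 i)) ∂(jointLaw ρ m) =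
      ∫ p, empRisk V Φ p.1 (u p) ∂(jointLaw ρ m) := by
  have hi1 := integrable_loss (P := jointLaw ρ m) hV hV0 hB hS hΦ hu (measurable_example i) hK
  have hi2 := integrable_empRisk (P := jointLaw ρ m) hV hV0 hB hS hΦ hu measurable_fst hK
  unfold jointLaw at *
  rw [integral_prod _ hi1, integral_prod _ hi2]
  congr 1
  funext z
  set ν := (PMF.uniformOfFintype (Fin m)).toMeasure
  have hex := measurePreserving_update ν i
  have hm : Measurable fun j : ℕ → Fin m => u (z, j) :=
    hu.comp (measurable_const.prodMk measurable_id)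
  have hz : Measurable fun j : ℕ → Fin m => z (j i) :=
    measurable_from_top.comp (measurable_pi_apply i)
  have hi3 := integrable_loss (P := Measure.infinitePi fun _ : ℕ => ν) hV hV0 hB hS hΦ hm hz
    (fun j => hK _)
  -- Redraw the `i`-th index independently: the predictor does not notice, and the new index can be
  -- averaged on its own.
  calc ∫ j, loss V Φ (u (z, j)) (z (j i)) ∂(Measure.infinitePi fun _ => ν)
      = ∫ q : (ℕ → Fin m) × Fin m, loss V Φ (u (z, q.1)) (z q.2)
          ∂((Measure.infinitePi fun _ => ν).prod ν) := by
        conv_lhs => rw [← hex.map_eq]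
        rw [integral_map hex.measurable.aemeasurable
          (by rw [hex.map_eq]; exact hi3.aestronglyMeasurable)]
        simp [hi]
    _ = _ := by
        have hi4 := integrable_loss (P := (Measure.infinitePi fun _ : ℕ => ν).prod ν) hV hV0 hB hS
          hΦ (w := fun q => u (z, q.1)) (x := fun q => z q.2) (hm.comp measurable_fst)
          (measurable_from_top.comp measurable_snd) (fun q => hK _)
        rw [integral_prod _ hi4]
        simp only [ν, integral_uniform]
        rfl

theorem integral_empRisk_const (hV : Measurable (Function.uncurry V)) (hV0 : ∀ y a, 0 ≤ V y a)
    (hB : Bounded Y V Φ κ a₀) (hS : Smooth Y V L) (hΦ : Measurable Φ) (u : F) :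
    ∫ p, empRisk V Φ p.1 u ∂(jointLaw ρ m) = risk ρ V Φ u := by
  have hi2 := integrable_empRisk (P := jointLaw ρ m) hV hV0 hB hS hΦ (w := fun _ => u)
    measurable_const measurable_fst (fun _ => le_rfl)
  unfold jointLaw at *
  rw [integral_prod _ hi2]
  simp only [integral_const, probReal_univ, one_smul, empRisk]
  rw [integral_const_mul, integral_finsetSum]
  · have h (i : Fin m) : ∫ z, loss V Φ u (z i) ∂(Measure.pi fun _ : Fin m => ρ) = risk ρ V Φ u :=
      integral_comp_eval (integrable_loss_const hV hV0 hB hS hΦ u).aestronglyMeasurable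
    have hm : (m : ℝ) ≠ 0 := NeZero.ne _
    simp [h, hm]
  · exact fun i _ => integrable_loss hV hV0 hB hS hΦ measurable_const (measurable_pi_apply i)
      (w := fun _ => u) (fun _ => le_rfl)

/-- The expected regret of the iterates between the times `s` and `t` against a predictor `u`. -/
theorem sum_mul_integral_empRisk_sub_le
    (hV : Measurable (Function.uncurry V)) (hV0 : ∀ y a, 0 ≤ V y a)
    (hB : Bounded Y V Φ κ a₀) (hS : Smooth Y V L) (hΦ : Measurable Φ)
    (hη : ∀ t, 1 ≤ t → 0 < η t) {s : ℕ} (hs : 1 ≤ s)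
    {u : (Fin m → X × Y) × (ℕ → Fin m) → F} (hu : Measurable u) {K : ℝ} (hK : ∀ p, ‖u p‖ ≤ K)
    (hi : ∀ z j i a, s ≤ i → u (z, Function.update j i a) = u (z, j)) (t : ℕ) (hst : s ≤ t) :
    ∑ i ∈ Finset.Ico s t, η i *
        (∫ p, empRisk V Φ p.1 (iterate V Φ η p.1 p.2 i) ∂(jointLaw ρ m) -
          ∫ p, empRisk V Φ p.1 (u p) ∂(jointLaw ρ m)) ≤
      (∫ p, ‖iterate V Φ η p.1 p.2 s - u p‖ ^ 2 ∂(jointLaw ρ m) +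
        (a₀ * κ) ^ 2 * ∑ i ∈ Finset.Ico s t, η i ^ 2) / 2 := by
  set P := jointLaw ρ m
  have hw (t) := measurable_iterate hV hS hΦ (m := m) η t
  have hKw (t) (p : (Fin m → X × Y) × (ℕ → Fin m)) := norm_iterate_le hB hη p.1 p.2 t
  have hsq (t : ℕ) : Integrable (fun p => ‖iterate V Φ η p.1 p.2 t - u p‖ ^ 2) P := by
    have := UniformSpace.secondCountable_of_separable F
    refine Integrable.of_bound (((hw t).sub hu).norm.pow_const 2).aestronglyMeasurable
      (((∑ k ∈ Finset.Ico 1 t, η k) * (a₀ * κ) + K) ^ 2) (Filter.Eventually.of_forall fun p => ?_)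
    rw [Real.norm_of_nonneg (by positivity)]
    gcongr
    exact (norm_sub_le _ _).trans (add_le_add (hKw t p) (hK p))
  -- The final squared distance is kept so that the induction telescopes; it is dropped only at the
  -- end.
  suffices h : ∫ p, ‖iterate V Φ η p.1 p.2 t - u p‖ ^ 2 ∂P ≤
      ∫ p, ‖iterate V Φ η p.1 p.2 s - u p‖ ^ 2 ∂P +
        (a₀ * κ) ^ 2 * ∑ i ∈ Finset.Ico s t, η i ^ 2 - 2 * ∑ i ∈ Finset.Ico s t, η i *
        (∫ p, empRisk V Φ p.1 (iterate V Φ η p.1 p.2 i) ∂P - ∫ p, empRisk V Φ p.1 (u p) ∂P) by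
    have h0 : 0 ≤ ∫ p, ‖iterate V Φ η p.1 p.2 t - u p‖ ^ 2 ∂P :=
      integral_nonneg fun _ => by positivity
    linarith
  induction t, hst using Nat.le_induction with
  | base => simp
  | succ t hst ih =>
    have ht : 1 ≤ t := hs.trans hst
    rw [Finset.sum_Ico_succ_top hst, Finset.sum_Ico_succ_top hst]
    have hi1 := integrable_loss (P := P) hV hV0 hB hS hΦ (hw t) (measurable_example t) (hKw t)
    have hi2 := integrable_loss (P := P) hV hV0 hB hS hΦ hu (measurable_example t) hK
    have hi3 : Integrable (fun p => ‖iterate V Φ η p.1 p.2 t - u p‖ ^ 2 +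
        η t ^ 2 * (a₀ * κ) ^ 2) P := (hsq t).add (integrable_const _)
    have hi4 : Integrable (fun p => 2 * η t * (loss V Φ (iterate V Φ η p.1 p.2 t) (p.1 (p.2 t)) -
        loss V Φ (u p) (p.1 (p.2 t)))) P := (hi1.sub hi2).const_mul _
    have e1 := integral_loss_example (ρ := ρ) hV hV0 hB hS hΦ t (hw t) (hKw t) fun z j a =>
      iterate_congr η z t fun r hr => Function.update_of_ne hr.ne _ _
    have e2 := integral_loss_example (ρ := ρ) hV hV0 hB hS hΦ t hu hK fun z j a => hi z j t a hst
    have hint : ∫ p, ‖iterate V Φ η p.1 p.2 (t + 1) - u p‖ ^ 2 ∂P ≤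
        ∫ p, (‖iterate V Φ η p.1 p.2 t - u p‖ ^ 2 + η t ^ 2 * (a₀ * κ) ^ 2 -
          2 * η t * (loss V Φ (iterate V Φ η p.1 p.2 t) (p.1 (p.2 t)) -
            loss V Φ (u p) (p.1 (p.2 t)))) ∂P := by
      refine integral_mono (hsq _) (hi3.sub hi4) fun p => ?_
      simp only [iterate_succ η _ _ ht]
      exact norm_step_sub_sq_le hB hS (hη t ht).le _ _ _
    rw [integral_sub hi3 hi4,
      integral_add (hsq t) (integrable_const _), integral_const, probReal_univ,
      one_smul, integral_const_mul, integral_sub hi1 hi2, e1, e2] at hint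
    linarith

end Expectation

/-! ### From averages to the last term of a real sequence. -/

section LastIterate

/-- The last term of a sequence is controlled by its average over the last `k + 1` terms and by
the deviations of the tails from their first term. -/
theorem last_le_average_add {b x : ℕ → ℝ} {t : ℕ} {D : ℝ}
    (h : ∀ s, 1 ≤ s → s < t → ∑ i ∈ Finset.Ico (s + 1) (t + 1), (b i - b s) ≤
      ∑ i ∈ Finset.Ico s t, x i + D) (k : ℕ) (hk : k < t) :
    b t ≤ (∑ i ∈ Finset.Ico (t - k) (t + 1), b i) / (k + 1) +
      ∑ i ∈ Finset.Ico (t - k) t, x i / ((t : ℝ) - i) -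
      (∑ i ∈ Finset.Ico (t - k) t, x i) / (k + 1) + D * (1 - 1 / (k + 1)) := by
  induction k with
  | zero => simp
  | succ k ih =>
    obtain ⟨s, rfl⟩ : ∃ s, t = s + (k + 1) := ⟨t - (k + 1), by omega⟩
    have e1 : s + (k + 1) - (k + 1) = s := by omega
    have e2 : s + (k + 1) - k = s + 1 := by omega
    have hs := h s (by omega) (by omega)
    have ih := ih (by omega)
    rw [e2] at ih
    rw [e1]
    have hlt : s < s + (k + 1) := by omega
    rw [Finset.sum_eq_sum_Ico_succ_bot hlt] at hs ⊢
    rw [Finset.sum_eq_sum_Ico_succ_bot hlt, Finset.sum_eq_sum_Ico_succ_bot (by omega)]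
    rw [Finset.sum_sub_distrib] at hs
    simp only [Finset.sum_const, Nat.card_Ico] at hs
    have e3 : s + (k + 1) + 1 - (s + 1) = k + 1 := by omega
    rw [e3, nsmul_eq_mul] at hs
    push_cast at hs ih ⊢
    generalize (∑ i ∈ Finset.Ico (s + 1) (s + (k + 1) + 1), b i) = B at *
    generalize (∑ i ∈ Finset.Ico (s + 1) (s + (k + 1)), x i) = Z at *
    generalize (∑ i ∈ Finset.Ico (s + 1) (s + (k + 1)), x i / ((s : ℝ) + (k + 1) - i)) = W at *
    refine ih.trans ?_
    have e4 : (s : ℝ) + (k + 1) - s = k + 1 := by ring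
    rw [e4]
    have hk : (0 : ℝ) < (k : ℝ) + 1 := by positivity
    have hk2 : (0 : ℝ) < (k : ℝ) + 1 + 1 := by positivity
    -- The bound for `k + 1` minus the bound for `k` is the slack in the tail inequality at `s = t -
    -- (k + 1)`, divided by `(k + 1) * (k + 2)`.
    have key : (b s + B) / (k + 1 + 1) + (x s / (k + 1) + W) - (x s + Z) / (k + 1 + 1) +
        D * (1 - 1 / (k + 1 + 1)) - (B / (k + 1) + W - Z / (k + 1) + D * (1 - 1 / (k + 1))) =
        (x s + Z + D - (B - (k + 1) * b s)) / ((k + 1) * (k + 1 + 1)) := by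
      field_simp
      ring
    have : 0 ≤ (x s + Z + D - (B - (k + 1) * b s)) / (((k : ℝ) + 1) * (k + 1 + 1)) :=
      div_nonneg (by linarith) (by positivity)
    linarith

/-- A bound on the last value of a sequence from its weighted average and from regret bounds
satisfied, up to an error `G`, by its tails. -/
theorem last_le_of_regret {a e η : ℕ → ℝ} {t : ℕ} (ht : 1 ≤ t) {A G D : ℝ}
    (hη : ∀ k, 1 ≤ k → 0 < η k) (hanti : AntitoneOn η (Set.Ici 1)) (ha : ∀ k, 0 ≤ a k)
    (hG : 0 ≤ G) (hgap : ∀ k, k ≤ t → |a k - e k| ≤ G)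
    (hreg : ∀ s, 1 ≤ s → s < t → ∑ i ∈ Finset.Ico s (t + 1), η i * (e i - e s) ≤
      A * ∑ i ∈ Finset.Ico s (t + 1), η i ^ 2)
    (havg : ∑ k ∈ Finset.Ico 1 (t + 1), η k * a k ≤
      D + A * ∑ k ∈ Finset.Ico 1 (t + 1), η k ^ 2 + G * ∑ k ∈ Finset.Ico 1 t, η k) :
    η t * a t ≤ D / t + A * (∑ k ∈ Finset.Ico 1 t, η k ^ 2 / ((t : ℝ) - k) + η t ^ 2) +
      2 * G * ∑ k ∈ Finset.Ico 1 t, η k / ((t : ℝ) - k) := by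
  -- The sums of `x` stop at `t - 1` while the regret runs up to `t`; the leftover `A * η t ^ 2` is
  -- the constant `D`.
  have key := last_le_average_add (b := fun i => η i * a i)
    (x := fun i => A * η i ^ 2 + 2 * G * η i) (t := t) (D := A * η t ^ 2) (fun s hs hst => ?_)
    (t - 1) (by omega)
  · have e1 : t - (t - 1) = 1 := by omega
    have e2 : (((t - 1 : ℕ) : ℝ)) + 1 = t := by
      rw [Nat.cast_sub ht]; simp
    rw [e1, e2] at key
    simp only [add_div, mul_div_assoc, Finset.sum_add_distrib, ← Finset.mul_sum] at key
    refine key.trans ?_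
    rw [Finset.sum_Ico_succ_top ht (fun k => η k ^ 2)] at havg
    have htp : (0 : ℝ) < t := by exact_mod_cast ht
    have h1 := div_le_div_of_nonneg_right havg htp.le
    -- The average costs `G` per step but `x` gives back `2 * G`; this surplus is discarded.
    have h2 : 0 ≤ G * ((∑ k ∈ Finset.Ico 1 t, η k) / t) :=
      mul_nonneg hG (div_nonneg (Finset.sum_nonneg fun k hk =>
        (hη k (Finset.mem_Ico.1 hk).1).le) htp.le)
    simp only [mul_add, add_div, mul_div_assoc] at h1
    rw [mul_sub, mul_one_div, mul_one, mul_div_assoc]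
    linarith
  · have h1 : ∀ i ∈ Finset.Ico (s + 1) (t + 1), η i * a i - η s * a s ≤
        η i * (e i - e s) + 2 * G * η i := by
      intro i hi
      rw [Finset.mem_Ico] at hi
      -- Here `a s ≥ 0` and decreasing steps allow `η s * a s` to be replaced by the smaller `η i *
      -- a s`.
      have h2 := mul_le_mul_of_nonneg_right (hanti hs (show 1 ≤ i by omega) (by omega : s ≤ i))
        (ha s)
      have h3 := (abs_le.1 (hgap i (by omega))).2
      have h4 := (abs_le.1 (hgap s (by omega))).1
      have h5 : a i - a s ≤ e i - e s + 2 * G := by linarith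
      have h6 := mul_le_mul_of_nonneg_left h5 (hη i (by omega)).le
      linarith
    refine (Finset.sum_le_sum h1).trans ?_
    have h2 := hreg s hs hst
    rw [Finset.sum_eq_sum_Ico_succ_bot (by omega), sub_self, mul_zero, zero_add,
      Finset.sum_Ico_succ_top hst.le (fun k => η k ^ 2)] at h2
    have h3 : ∑ i ∈ Finset.Ico (s + 1) (t + 1), η i ≤ ∑ i ∈ Finset.Ico s t, η i := by
      rw [← Finset.sum_Ico_add' η s t 1]
      refine Finset.sum_le_sum fun i hi => ?_
      rw [Finset.mem_Ico] at hi
      exact hanti (show 1 ≤ i by omega) (show 1 ≤ i + 1 by omega) (by omega)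
    have h4 := mul_le_mul_of_nonneg_left h3 (show 0 ≤ 2 * G by linarith)
    simp only [Finset.sum_add_distrib, ← Finset.mul_sum]
    linarith

end LastIterate

/-! ### Expected excess risk of the iterates. -/

section Excess

variable {X : Type*} [MeasurableSpace X] {Y : Set ℝ} {F : Type*} [NormedAddCommGroup F]
  [InnerProductSpace ℝ F] [TopologicalSpace.SeparableSpace F] [MeasurableSpace F] [BorelSpace F]
  {V : ℝ → ℝ → ℝ} {Φ : X → F} {κ a₀ L : ℝ} {ρ : Measure (X × Y)} [IsProbabilityMeasure ρ]
  {m : ℕ} [NeZero m] {η : ℕ → ℝ}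

/-- The weighted sum of the expected excess risks of the iterates. -/
theorem sum_mul_integral_risk_sub_infRisk_le
    (hV : Measurable (Function.uncurry V)) (hV0 : ∀ y a, 0 ≤ V y a)
    (hB : Bounded Y V Φ κ a₀) (hS : Smooth Y V L) (hΦ : Measurable Φ)
    (hη : ∀ t, 1 ≤ t → 0 < η t) (hL : ∀ t, 1 ≤ t → η t * (κ ^ 2 * L) ≤ 2)
    {t : ℕ} (ht : 1 ≤ t) :
    ∑ k ∈ Finset.Ico 1 (t + 1), η k *
        (∫ p, risk ρ V Φ (iterate V Φ η p.1 p.2 k) ∂(jointLaw ρ m) - infRisk ρ V Φ) ≤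
      (∑ k ∈ Finset.Ico 1 (t + 1), η k) *
          approxError ρ V Φ (1 / ∑ k ∈ Finset.Ico 1 (t + 1), η k) +
        (a₀ * κ) ^ 2 / 2 * ∑ k ∈ Finset.Ico 1 (t + 1), η k ^ 2 +
        2 * (a₀ * κ) ^ 2 / m * (∑ k ∈ Finset.Ico 1 (t + 1), η k) * ∑ k ∈ Finset.Ico 1 t, η k := by
  set S := ∑ k ∈ Finset.Ico 1 (t + 1), η k with hSdef
  set T := ∑ k ∈ Finset.Ico 1 t, η k with hTdef
  set a : ℕ → ℝ := fun k => ∫ p, risk ρ V Φ (iterate V Φ η p.1 p.2 k) ∂(jointLaw ρ m) with ha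
  set e : ℕ → ℝ := fun k => ∫ p, empRisk V Φ p.1 (iterate V Φ η p.1 p.2 k) ∂(jointLaw ρ m) with he
  have hSpos : 0 < S := Finset.sum_pos (fun k hk => hη k (Finset.mem_Ico.1 hk).1)
    ⟨1, Finset.mem_Ico.2 ⟨le_rfl, by omega⟩⟩
  have hgap : ∀ k ∈ Finset.Ico 1 (t + 1), η k * (a k - e k) ≤
      η k * (2 * (a₀ * κ) ^ 2 / m * T) := by
    intro k hk
    rw [Finset.mem_Ico] at hk
    have hT : ∑ i ∈ Finset.Ico 1 k, η i ≤ T :=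
      Finset.sum_le_sum_of_subset_of_nonneg (Finset.Ico_subset_Ico le_rfl (by omega))
        fun i hi _ => (hη i (Finset.mem_Ico.1 hi).1).le
    refine mul_le_mul_of_nonneg_left ?_ (hη k hk.1).le
    exact ((le_abs_self _).trans (abs_integral_risk_iterate_sub_le hV hV0 hB hS hΦ hη hL k)).trans
      (mul_le_mul_of_nonneg_left hT (by positivity))
  have hsum := Finset.sum_le_sum hgap
  rw [← Finset.sum_mul] at hsum
  -- Each `u` gives a bound with penalty `‖u‖ ^ 2 / (2 * S)`, so the left side lies below the
  -- regularized infimum at `lam = 1 / S`.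
  have hmain : (∑ k ∈ Finset.Ico 1 (t + 1), η k * a k -
      (a₀ * κ) ^ 2 / 2 * ∑ k ∈ Finset.Ico 1 (t + 1), η k ^ 2 -
      2 * (a₀ * κ) ^ 2 / m * S * T) / S ≤
      ⨅ u : F, (risk ρ V Φ u + 1 / S / 2 * ‖u‖ ^ 2) := by
    refine le_ciInf fun u => ?_
    have hreg := sum_mul_integral_empRisk_sub_le (ρ := ρ) (m := m) hV hV0 hB hS hΦ hη le_rfl
      (u := fun _ => u) measurable_const (fun _ => le_rfl) (fun _ _ _ _ _ => rfl) (t + 1)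
      (by omega)
    simp only [integral_empRisk_const hV hV0 hB hS hΦ, iterate_one, zero_sub, norm_neg,
      integral_const, probReal_univ, one_smul] at hreg
    rw [div_le_iff₀ hSpos]
    have h1 : (risk ρ V Φ u + 1 / S / 2 * ‖u‖ ^ 2) * S = risk ρ V Φ u * S + ‖u‖ ^ 2 / 2 := by
      field_simp
    rw [h1]
    simp only [mul_sub, Finset.sum_sub_distrib, ← Finset.sum_mul] at hreg hsum
    linarith
  rw [div_le_iff₀ hSpos] at hmain
  simp only [approxError, mul_sub, Finset.sum_sub_distrib, ← Finset.sum_mul]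
  linarith

/-- The expected excess risk of the last iterate, multiplied by the last step size. -/
theorem mul_integral_risk_iterate_sub_infRisk_le
    (hV : Measurable (Function.uncurry V)) (hV0 : ∀ y a, 0 ≤ V y a)
    (hB : Bounded Y V Φ κ a₀) (hS : Smooth Y V L) (hΦ : Measurable Φ)
    (hη : ∀ t, 1 ≤ t → 0 < η t) (hanti : AntitoneOn η (Set.Ici 1))
    (hL : ∀ t, 1 ≤ t → η t * (κ ^ 2 * L) ≤ 2) {t : ℕ} (ht : 1 ≤ t) :
    η t * (∫ p, risk ρ V Φ (iterate V Φ η p.1 p.2 t) ∂(jointLaw ρ m) - infRisk ρ V Φ) ≤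
      (∑ k ∈ Finset.Ico 1 (t + 1), η k) *
          approxError ρ V Φ (1 / ∑ k ∈ Finset.Ico 1 (t + 1), η k) / t +
        (a₀ * κ) ^ 2 / 2 * (∑ k ∈ Finset.Ico 1 t, η k ^ 2 / ((t : ℝ) - k) + η t ^ 2) +
        2 * (2 * (a₀ * κ) ^ 2 / m * ∑ k ∈ Finset.Ico 1 (t + 1), η k) *
          ∑ k ∈ Finset.Ico 1 t, η k / ((t : ℝ) - k) := by
  have hw (t) := measurable_iterate hV hS hΦ (m := m) η t
  have hK (t) (p : (Fin m → X × Y) × (ℕ → Fin m)) := norm_iterate_le hB hη p.1 p.2 t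
  have hSnonneg : 0 ≤ ∑ k ∈ Finset.Ico 1 (t + 1), η k :=
    Finset.sum_nonneg fun k hk => (hη k (Finset.mem_Ico.1 hk).1).le
  refine last_le_of_regret
    -- Subtracting `infRisk` leaves gaps and regrets unchanged and keeps `a` nonnegative.
    (a := fun k => ∫ p, risk ρ V Φ (iterate V Φ η p.1 p.2 k) ∂(jointLaw ρ m) - infRisk ρ V Φ)
    (e := fun k => ∫ p, empRisk V Φ p.1 (iterate V Φ η p.1 p.2 k) ∂(jointLaw ρ m) -
      infRisk ρ V Φ) ht hη hanti (fun k => ?_) (by positivity) (fun k hk => ?_)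
    (fun s hs hst => ?_) (sum_mul_integral_risk_sub_infRisk_le hV hV0 hB hS hΦ hη hL ht)
  · have h := integral_mono (μ := jointLaw ρ m) (integrable_const (infRisk ρ V Φ))
      (integrable_risk hV hV0 hB hS hΦ (hw k) (hK k)) fun p => infRisk_le hV0 _
    rw [integral_const, probReal_univ, one_smul] at h
    exact sub_nonneg.2 h
  · rw [sub_sub_sub_cancel_right]
    refine (abs_integral_risk_iterate_sub_le hV hV0 hB hS hΦ hη hL k).trans ?_
    exact mul_le_mul_of_nonneg_left (Finset.sum_le_sum_of_subset_of_nonneg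
      (Finset.Ico_subset_Ico le_rfl (by omega)) fun i hi _ => (hη i (Finset.mem_Ico.1 hi).1).le)
      (by positivity)
  · have h := sum_mul_integral_empRisk_sub_le (ρ := ρ) (m := m) hV hV0 hB hS hΦ hη hs (hw s) (hK s)
      (fun z j i a hi => iterate_congr η z s fun r hr =>
        Function.update_of_ne (by omega) _ _) (t + 1) (by omega)
    simp only [sub_self, norm_zero, ne_eq, OfNat.ofNat_ne_zero, not_false_eq_true, zero_pow,
      integral_zero, zero_add] at h
    simp only [sub_sub_sub_cancel_right]
    linarith

end Excess

end SGM

end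

/-! ### The two bounds with an explicit constant. -/

theorem theorem2 (a₀ κ c : ℝ) :
    ∃ C : ℝ, 0 < C ∧
      ∀ (X : Type*) [MeasurableSpace X] (Y : Set ℝ)
        (F : Type*) [NormedAddCommGroup F] [InnerProductSpace ℝ F] [CompleteSpace F]
        [TopologicalSpace.SeparableSpace F] [MeasurableSpace F] [BorelSpace F]
        (ρ : Measure (X × Y)) [IsProbabilityMeasure ρ]
        (V : ℝ → ℝ → ℝ) (_ : Measurable (Function.uncurry V)) (_ : ∀ y a, 0 ≤ V y a)
        (Φ : X → F) (_ : Measurable Φ)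
        (_ : SGM.Bounded Y V Φ κ a₀)
        (β : ℝ) (_ : 0 < β) (_ : β ≤ 1) (_ : 0 < c)
        (_ : ∀ lam : ℝ, 0 < lam → SGM.approxError ρ V Φ lam ≤ c * lam ^ β)
        (L : ℝ) (_ : SGM.Smooth Y V L)
        (η : ℕ → ℝ) (_ : ∀ t, 1 ≤ t → 0 < η t) (_ : AntitoneOn η (Set.Ici 1))
        (_ : ∀ t, 1 ≤ t → η t * (κ ^ 2 * L) ≤ 2)
        (m : ℕ) [NeZero m] (t : ℕ) (_ : 1 ≤ t),
        (Integrable (fun p : (Fin m → X × Y) × (ℕ → Fin m) =>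
              SGM.risk ρ V Φ (SGM.avgIterate V Φ η p.1 p.2 t) - SGM.infRisk ρ V Φ)
            (SGM.jointLaw ρ m) ∧
          ∫ p, (SGM.risk ρ V Φ (SGM.avgIterate V Φ η p.1 p.2 t) - SGM.infRisk ρ V Φ)
              ∂(SGM.jointLaw ρ m) ≤
            C * ((∑ k ∈ Finset.Icc 1 t, η k) / m
              + (∑ k ∈ Finset.Icc 1 t, η k ^ 2) / (∑ k ∈ Finset.Icc 1 t, η k)
              + (1 / ∑ k ∈ Finset.Icc 1 t, η k) ^ β)) ∧
        (Integrable (fun p : (Fin m → X × Y) × (ℕ → Fin m) =>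
              SGM.risk ρ V Φ (SGM.iterate V Φ η p.1 p.2 t) - SGM.infRisk ρ V Φ)
            (SGM.jointLaw ρ m) ∧
          ∫ p, (SGM.risk ρ V Φ (SGM.iterate V Φ η p.1 p.2 t) - SGM.infRisk ρ V Φ)
              ∂(SGM.jointLaw ρ m) ≤
            C * ((∑ k ∈ Finset.Icc 1 t, η k) / m
                * (∑ k ∈ Finset.Ico 1 t, η k / (η t * ((t : ℝ) - k)))
              + ((∑ k ∈ Finset.Ico 1 t, η k ^ 2 / (η t * ((t : ℝ) - k))) + η t)
              + (∑ k ∈ Finset.Icc 1 t, η k) ^ (1 - β) / (η t * t))) := by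
  -- The constant is chosen before `0 < c` is known, hence `|c|` and the `+ 1`; the coefficients of
  -- `(a₀ * κ) ^ 2` to be covered are `1 / 2`, `2` and `4`.
  refine ⟨|c| + 5 * (a₀ * κ) ^ 2 + 1, by positivity, ?_⟩
  intro X _ Y F _ _ _ _ _ _ ρ _ V hV hV0 Φ hΦ hB β hβ hβ1 hc hD L hS η hη hanti hL m _ t ht
  have hw := SGM.measurable_iterate hV hS hΦ (m := m) η t
  have hK (p : (Fin m → X × Y) × (ℕ → Fin m)) := SGM.norm_iterate_le hB hη p.1 p.2 t
  have hpos : ∀ k ∈ Finset.Icc 1 t, 0 < η k := fun k hk => hη k (Finset.mem_Icc.1 hk).1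
  have hpos' : ∀ k ∈ Finset.Ico 1 t, 0 < η k := fun k hk => hη k (Finset.mem_Ico.1 hk).1
  have hint (k : ℕ) := SGM.integrable_risk (ρ := ρ) (P := SGM.jointLaw ρ m) hV hV0 hB hS hΦ
    (SGM.measurable_iterate hV hS hΦ (m := m) η k) fun p => SGM.norm_iterate_le hB hη p.1 p.2 k
  have hinta := SGM.integrable_risk (ρ := ρ) (P := SGM.jointLaw ρ m) hV hV0 hB hS hΦ
    (SGM.measurable_avgIterate hV hS hΦ (m := m) η t) fun p =>
      SGM.norm_avgIterate_le hB hη p.1 p.2 t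
  have hsum := SGM.sum_mul_integral_risk_sub_infRisk_le (ρ := ρ) (m := m) hV hV0 hB hS hΦ hη hL ht
  have hlast := SGM.mul_integral_risk_iterate_sub_infRisk_le (ρ := ρ) (m := m) hV hV0 hB hS hΦ hη
    hanti hL ht
  have hIcc : Finset.Ico 1 (t + 1) = Finset.Icc 1 t := by
    ext k
    simp
  rw [hIcc] at hsum hlast
  have hηt := hη t ht
  have htpos : (0 : ℝ) < t := by exact_mod_cast ht
  have hmpos : (0 : ℝ) < m := by exact_mod_cast Nat.pos_of_ne_zero (NeZero.ne m)
  have hSpos : 0 < ∑ k ∈ Finset.Icc 1 t, η k := Finset.sum_pos hpos ⟨1, by simp [ht]⟩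
  have hTS : ∑ k ∈ Finset.Ico 1 t, η k ≤ ∑ k ∈ Finset.Icc 1 t, η k :=
    Finset.sum_le_sum_of_subset_of_nonneg Finset.Ico_subset_Icc_self fun i hi _ => (hpos i hi).le
  have hsub : ∀ k ∈ Finset.Ico 1 t, (0 : ℝ) < t - k := fun k hk =>
    sub_pos.2 (by exact_mod_cast (Finset.mem_Ico.1 hk).2)
  have hU : 0 ≤ ∑ k ∈ Finset.Ico 1 t, η k ^ 2 / ((t : ℝ) - k) :=
    Finset.sum_nonneg fun k hk => div_nonneg (sq_nonneg _) (hsub k hk).le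
  have hW : 0 ≤ ∑ k ∈ Finset.Ico 1 t, η k / ((t : ℝ) - k) :=
    Finset.sum_nonneg fun k hk => div_nonneg (hpos' k hk).le (hsub k hk).le
  have hQ : 0 ≤ ∑ k ∈ Finset.Icc 1 t, η k ^ 2 := Finset.sum_nonneg fun _ _ => sq_nonneg _
  have hU' : ∑ k ∈ Finset.Ico 1 t, η k ^ 2 / (η t * ((t : ℝ) - k)) =
      (∑ k ∈ Finset.Ico 1 t, η k ^ 2 / ((t : ℝ) - k)) / η t := by
    rw [Finset.sum_div]
    exact Finset.sum_congr rfl fun k _ => by rw [div_div, mul_comm (η t)]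
  have hW' : ∑ k ∈ Finset.Ico 1 t, η k / (η t * ((t : ℝ) - k)) =
      (∑ k ∈ Finset.Ico 1 t, η k / ((t : ℝ) - k)) / η t := by
    rw [Finset.sum_div]
    exact Finset.sum_congr rfl fun k _ => by rw [div_div, mul_comm (η t)]
  have hDS := hD _ (one_div_pos.2 hSpos)
  refine ⟨⟨hinta.sub (integrable_const _), ?_⟩, (hint t).sub (integrable_const _), ?_⟩
  · rw [integral_sub hinta (integrable_const _), integral_const, probReal_univ, one_smul]
    have hmono : ∫ p, SGM.risk ρ V Φ (SGM.avgIterate V Φ η p.1 p.2 t) ∂(SGM.jointLaw ρ m) ≤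
        (∑ k ∈ Finset.Icc 1 t, η k)⁻¹ * ∑ k ∈ Finset.Icc 1 t, η k *
          ∫ p, SGM.risk ρ V Φ (SGM.iterate V Φ η p.1 p.2 k) ∂(SGM.jointLaw ρ m) := by
      refine (integral_mono hinta ((integrable_finsetSum _ fun k _ =>
        (hint k).const_mul (η k)).const_mul _) fun p =>
          SGM.risk_avgIterate_le hV hV0 hB hS hΦ hη p.1 p.2 ht).trans_eq ?_
      rw [integral_const_mul, integral_finsetSum _ fun k _ => (hint k).const_mul (η k)]
      simp only [integral_const_mul]
    simp only [mul_sub, Finset.sum_sub_distrib, ← Finset.sum_mul] at hsum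
    generalize ∑ k ∈ Finset.Icc 1 t, η k * ∫ p, SGM.risk ρ V Φ (SGM.iterate V Φ η p.1 p.2 k)
      ∂(SGM.jointLaw ρ m) = E at *
    generalize ∑ k ∈ Finset.Icc 1 t, η k = S at *
    generalize ∑ k ∈ Finset.Ico 1 t, η k = T at *
    generalize ∑ k ∈ Finset.Icc 1 t, η k ^ 2 = Q at *
    have hp : 0 ≤ (1 / S) ^ β := Real.rpow_nonneg (one_div_pos.2 hSpos).le β
    have h1 : S⁻¹ * E - SGM.infRisk ρ V Φ ≤ SGM.approxError ρ V Φ (1 / S) +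
        (a₀ * κ) ^ 2 / 2 * (Q / S) + 2 * (a₀ * κ) ^ 2 * (T / m) := by
      have h2 := div_le_div_of_nonneg_right hsum hSpos.le
      have e1 : S⁻¹ * E - SGM.infRisk ρ V Φ = (E - S * SGM.infRisk ρ V Φ) / S := by
        field_simp
      rw [e1]
      refine h2.trans_eq ?_
      field_simp
    have h3 : T / m ≤ S / m := by gcongr
    have h4 : 0 ≤ S / m := by positivity
    have h5 : 0 ≤ Q / S := by positivity
    have hc' := abs_of_pos hc
    rw [hc']
    have h6 : 2 * (a₀ * κ) ^ 2 * (T / m) ≤ 2 * (a₀ * κ) ^ 2 * (S / m) := by gcongr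
    have h7 : 0 ≤ (a₀ * κ) ^ 2 := sq_nonneg _
    nlinarith [mul_nonneg h7 h4, mul_nonneg h7 h5, mul_nonneg h7 hp, mul_nonneg hc.le h4,
      mul_nonneg hc.le h5]
  · rw [integral_sub (hint t) (integrable_const _), integral_const, probReal_univ, one_smul,
      hU', hW']
    generalize ∫ p, SGM.risk ρ V Φ (SGM.iterate V Φ η p.1 p.2 t) ∂(SGM.jointLaw ρ m) -
      SGM.infRisk ρ V Φ = E at *
    have hSβ : (∑ k ∈ Finset.Icc 1 t, η k) ^ (1 - β) =
        (∑ k ∈ Finset.Icc 1 t, η k) * (1 / ∑ k ∈ Finset.Icc 1 t, η k) ^ β := by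
      rw [Real.rpow_sub hSpos, Real.rpow_one, Real.div_rpow zero_le_one hSpos.le, Real.one_rpow,
        mul_one_div]
    rw [hSβ]
    generalize ∑ k ∈ Finset.Icc 1 t, η k = S at *
    generalize ∑ k ∈ Finset.Ico 1 t, η k ^ 2 / ((t : ℝ) - k) = U at *
    generalize ∑ k ∈ Finset.Ico 1 t, η k / ((t : ℝ) - k) = W at *
    have hp : 0 ≤ (1 / S) ^ β := Real.rpow_nonneg (one_div_pos.2 hSpos).le β
    have h1 : E ≤ c * (S * (1 / S) ^ β / (η t * t)) + (a₀ * κ) ^ 2 / 2 * (U / η t + η t) +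
        4 * (a₀ * κ) ^ 2 * (S / m * (W / η t)) := by
      rw [← mul_le_mul_iff_right₀ hηt]
      have h2 : S * SGM.approxError ρ V Φ (1 / S) / t ≤ S * (c * (1 / S) ^ β) / t := by gcongr
      refine (hlast.trans (add_le_add_left (add_le_add_left h2 _) _)).trans_eq ?_
      field_simp
      ring
    have h3 : 0 ≤ S * (1 / S) ^ β / (η t * t) := by positivity
    have h4 : 0 ≤ U / η t + η t := by positivity
    have h5 : 0 ≤ S / m * (W / η t) := by positivity
    have h7 : 0 ≤ (a₀ * κ) ^ 2 := sq_nonneg _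
    rw [abs_of_pos hc]
    nlinarith [mul_nonneg h7 h3, mul_nonneg h7 h4, mul_nonneg h7 h5, mul_nonneg hc.le h4,
      mul_nonneg hc.le h5]
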